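/- Let $\mathbb D^*=\{z\in\mathbb C : 0<|z|<1\}$. For $z\in\mathbb D^*$ let $G_z$ be the semigroup generated, under composition, by the two contracting similarities $f:x\mapsto zx$ and $g:x\mapsto z(x-1)+1$ of $\mathbb C$, and let its limit set $\Lambda_z\subseteq\mathbb C$ be the closure of the set of fixed points of elements of $G_z$. Let the connectedness locus $\mathcal M\subseteq\mathbb D^*$ be the set of $z\in\mathbb D^*$ for which $\Lambda_z$ is connected. Theorem (Interior is almost dense; Bandt's Conjecture). The interior of $\mathcal M$ is dense in $\mathcal M$ away from the real axis; that is, $$\mathcal M=\overline{\mathrm{int}(\mathcal M)}\cup(\mathcal M\cap\mathbb R),$$ where interior and closure are taken in the parameter space $\mathbb D^*$. -/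

import Mathlib

namespace SchottkySemigroup

/-- The punctured open unit disk `𝔻* = {z ∈ ℂ | 0 < |z| < 1}`, with the subspace topology. -/
abbrev PuncturedDisk : Type := {z : ℂ // 0 < ‖z‖ ∧ ‖z‖ < 1}

/-- The similarity of `ℂ` with center `c` and dilation `z`, as an element of the monoid of
self-maps of `ℂ` under composition. -/
def similarity (z c : ℂ) : Function.End ℂ := fun x => z * (x - c) + c

/-- The semigroup `G_z` generated, under composition, by `f : x ↦ z x` and
`g : x ↦ z (x - 1) + 1`. -/
def semigroup (z : ℂ) : Subsemigroup (Function.End ℂ) :=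
  Subsemigroup.closure {similarity z 0, similarity z 1}

/-- The limit set `Λ` of a semigroup of self-maps of `ℂ`: the closure of the set of fixed points
of its elements. -/
def limitSet (G : Subsemigroup (Function.End ℂ)) : Set ℂ :=
  closure {x : ℂ | ∃ h ∈ G, Function.IsFixedPt h x}

/-- The connectedness locus `ℳ`: the set of parameters `z ∈ 𝔻*` such that `Λ_z` is connected. -/
def connectednessLocus : Set PuncturedDisk :=
  {z | IsConnected (limitSet (semigroup (z : ℂ)))}

end SchottkySemigroup

open Filter Topology Set

/-! An affine change of coordinates turns `Λ_z` into the set K of values at z of all power series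
with coefficients ±1. It is connected exactly when 1 + zK and −1 + zK meet
(`mem_connectednessLocus_iff`), and compactness of the coefficient space makes the locus closed. For
|z|² > 1/2 an area comparison forces the pieces to meet (`overlap_of_half_lt`). The circle |z|² =
1/2 lies in the closure of that region, so only nonreal z₀ in the locus with |z₀|² < 1/2 remain.

At such z₀ two series a, b with opposite constant terms agree. The top side of the convex hull of K
is horizontal, its ends p, q lie in K, and its midpoint does not
(`two_mul_re_signSeries_ne_of_im_le`). With m = (q − p)/2, the sets K and K − m interlock along the
top: a path from p to q close to K must cross its translate by −m
(`exists_eq_of_alternating_endpoints`). This configuration survives small changes of z and m, which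
gives a trap: if 1 + zK and −1 + zK were disjoint, two subpieces with relative displacement about m
z^(n+1) would come closer than the minimal distance (`exists_eventually_overlap`). By Hurwitz's
theorem there are w arbitrarily near z₀ at which truncations of a and b differ by exactly m w^(n+1)
(`exists_sum_sub_sum_eq`). The trap works on a neighbourhood of w, so w is interior to the locus. -/

/-! ### Crossing of plane paths by a winding argument -/

/-- The difference of the two logarithms is continuous and takes values in a coset of 2πiℤ, so it is
constant. -/
theorem sub_eq_log_sub_log_of_mul_exp_mem_slitPlane {G : ℝ → ℂ} (hG : Continuous G) {c : ℂ}
    (hc : c ≠ 0) (h : ∀ t, c * Complex.exp (G t) ∈ Complex.slitPlane) (s t : ℝ) :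
    G t - G s = Complex.log (c * Complex.exp (G t)) - Complex.log (c * Complex.exp (G s)) := by
  set D : ℝ → ℂ := fun t => Complex.log (c * Complex.exp (G t)) - G t with hD
  have hDc : Continuous D :=
    ((continuous_const.mul (Complex.continuous_exp.comp hG)).clog h).sub hG
  have hexp : ∀ t, Complex.exp (D t) = c := fun t => by
    rw [hD, Complex.exp_sub, Complex.exp_log (mul_ne_zero hc (Complex.exp_ne_zero _)),
      mul_div_cancel_right₀ _ (Complex.exp_ne_zero _)]
  have hint : ∀ t, ∃ n : ℤ, D t = D s + n * (2 * Real.pi * Complex.I) := fun t =>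
    Complex.exp_eq_exp_iff_exists_int.1 ((hexp t).trans (hexp s).symm)
  choose n hn using hint
  have hnc : Continuous n := by
    rw [Int.isClosedEmbedding_coe_real.isInducing.continuous_iff]
    have : ((↑) : ℤ → ℝ) ∘ n = fun t => ((D t).im - (D s).im) / (2 * Real.pi) := by
      funext t
      have := congrArg Complex.im (hn t)
      simp at this
      simp only [Function.comp_apply]
      rw [this]
      field_simp
      ring
    rw [this]
    fun_prop
  have h0 : D t = D s := by
    rw [hn t, PreconnectedSpace.constant inferInstance hnc (x := t) (y := s), ← hn s]
  simp only [hD] at h0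
  linear_combination -h0

/-- As |arg u| < π/2, adding ±π/2 to the argument never crosses the branch cut. This is the cost of
switching branches at a corner of the parameter square. -/
theorem log_I_mul_sub_log_neg_I_mul_of_re_pos {u : ℂ} (hu : 0 < u.re) :
    Complex.log (Complex.I * u) - Complex.log (-Complex.I * u) = Real.pi * Complex.I := by
  have h0 : u ≠ 0 := fun h => by simp [h] at hu
  have hu' := abs_lt.1 (Complex.abs_arg_lt_pi_div_two_iff.2 (Or.inl hu))
  rw [Complex.log_mul (by simp) h0, Complex.log_mul (by simp) h0]
  · simp [Complex.log_I, Complex.log_neg_I]; ring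
  · rw [Complex.arg_neg_I]; constructor <;> linarith [hu'.1, hu'.2]
  · rw [Complex.arg_I]; constructor <;> linarith [hu'.1, hu'.2]

theorem log_I_mul_sub_log_neg_I_mul_of_re_neg {u : ℂ} (hu : u.re < 0) :
    Complex.log (Complex.I * u) - Complex.log (-Complex.I * u) = -(Real.pi * Complex.I) := by
  have := log_I_mul_sub_log_neg_I_mul_of_re_pos (u := -u) (by simpa using hu)
  simp only [mul_neg, neg_mul, neg_neg] at this ⊢
  linear_combination -this

/-- Two paths, whose endpoints alternate horizontally and each of which avoids the upward vertical
rays from the endpoints of the other one, meet. -/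
theorem exists_eq_of_alternating_endpoints {p q x y : ℂ} (γ₁ : Path p q) (γ₂ : Path x y)
    (hx : ∀ s, ∀ τ : ℝ, 0 ≤ τ → γ₁ s ≠ x + τ * Complex.I)
    (hy : ∀ s, ∀ τ : ℝ, 0 ≤ τ → γ₁ s ≠ y + τ * Complex.I)
    (hp : ∀ t, ∀ τ : ℝ, 0 ≤ τ → γ₂ t ≠ p + τ * Complex.I)
    (hq : ∀ t, ∀ τ : ℝ, 0 ≤ τ → γ₂ t ≠ q + τ * Complex.I)
    (hxp : x.re < p.re) (hpy : p.re < y.re) (hyq : y.re < q.re) : ∃ s t, γ₁ s = γ₂ t := by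
  by_contra! hne
  -- If the paths miss each other, F has a global logarithm G, whose total change around the unit
  -- square is 0. On each side F avoids a vertical half-line, so that change is also given by a
  -- fixed branch. Only the corner (0, 1) has negative real part, and the branch switches add up to
  -- −2πi.
  set F : ℝ × ℝ → ℂ := fun v => γ₁.extend v.1 - γ₂.extend v.2 with hF
  have hFc : Continuous F := by
    apply Continuous.sub
    · exact γ₁.continuous_extend.comp continuous_fst
    · exact γ₂.continuous_extend.comp continuous_snd
  have hF0 : ∀ v, F v ≠ 0 := fun v => sub_ne_zero.2 (hne _ _)
  have hsc : IsSimplyConnected (univ : Set (ℝ × ℝ)) := by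
    have := (convex_univ (𝕜 := ℝ) (E := ℝ × ℝ)).contractibleSpace univ_nonempty
    exact SimplyConnectedSpace.ofContractible _
  obtain ⟨G, hGc, hG⟩ := Complex.exists_continuousOn_eqOn_exp_comp hsc isOpen_univ
    hFc.continuousOn (by rintro ⟨v, -, hv⟩; exact hF0 v hv)
  rw [← continuousOn_univ] at hFc
  have hGc : Continuous G := continuousOn_univ.1 hGc
  have hG : ∀ v, Complex.exp (G v) = F v := fun v => hG (mem_univ v)
  have up : ∀ a b : ℂ, (∀ τ : ℝ, 0 ≤ τ → a ≠ b + τ * Complex.I) →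
      Complex.I * (a - b) ∈ Complex.slitPlane := by
    intro a b h
    rw [Complex.mem_slitPlane_iff]
    by_contra! hcon
    simp at hcon
    refine h (a.im - b.im) (by linarith) ?_
    apply Complex.ext <;> simp
    linarith [hcon.2]
  have dn : ∀ a b : ℂ, (∀ τ : ℝ, 0 ≤ τ → b ≠ a + τ * Complex.I) →
      -Complex.I * (a - b) ∈ Complex.slitPlane := by
    intro a b h
    have := up b a h
    rwa [← neg_sub a b, mul_neg, ← neg_mul] at this
  have e1 := sub_eq_log_sub_log_of_mul_exp_mem_slitPlane (G := fun s => G (s, 0))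
    (hGc.comp (by fun_prop)) (c := Complex.I) (by simp)
    (fun s => by rw [hG]; simp only [hF, Path.extend_zero]; exact up _ _ (hx _)) 0 1
  have e2 := sub_eq_log_sub_log_of_mul_exp_mem_slitPlane (G := fun t => G (1, t))
    (hGc.comp (by fun_prop)) (c := -Complex.I) (by simp)
    (fun s => by rw [hG]; simp only [hF, Path.extend_one]; exact dn _ _ (hq _)) 0 1
  have e3 := sub_eq_log_sub_log_of_mul_exp_mem_slitPlane (G := fun s => G (s, 1))
    (hGc.comp (by fun_prop)) (c := Complex.I) (by simp)
    (fun s => by rw [hG]; simp only [hF, Path.extend_one]; exact up _ _ (hy _)) 1 0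
  have e4 := sub_eq_log_sub_log_of_mul_exp_mem_slitPlane (G := fun t => G (0, t))
    (hGc.comp (by fun_prop)) (c := -Complex.I) (by simp)
    (fun s => by rw [hG]; simp only [hF, Path.extend_zero]; exact dn _ _ (hp _)) 1 0
  simp only [hG] at e1 e2 e3 e4
  have f1 := log_I_mul_sub_log_neg_I_mul_of_re_pos (u := F (0, 0)) (by simpa [hF] using hxp)
  have f2 := log_I_mul_sub_log_neg_I_mul_of_re_pos (u := F (1, 0))
    (by simpa [hF] using hxp.trans (hpy.trans hyq))
  have f3 := log_I_mul_sub_log_neg_I_mul_of_re_pos (u := F (1, 1)) (by simpa [hF] using hyq)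
  have f4 := log_I_mul_sub_log_neg_I_mul_of_re_neg (u := F (0, 1)) (by simpa [hF] using hpy)
  have : (2 * (Real.pi * Complex.I) : ℂ) = 0 := by
    linear_combination e1 + e2 + e3 + e4 - f1 + f2 - f3 + f4
  simp [Real.pi_ne_zero] at this

/-! ### Series with coefficients ±1 and their attractor -/

namespace SchottkySemigroup

/-- The sign `1` or `-1` encoded by a Boolean. -/
def sign (b : Bool) : ℝ := if b then 1 else -1

/-- The value at `z` of the power series with coefficients `±1` encoded by `a`. -/
noncomputable def signSeries (z : ℂ) (a : ℕ → Bool) : ℂ := ∑' i, (sign (a i) : ℂ) * z ^ i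

/-- The set of values at `z` of all power series with coefficients `±1`. -/
def attractor (z : ℂ) : Set ℂ := range (signSeries z)

/-- The parameters `z` for which the two pieces `1 + z K` and `-1 + z K` of the attractor `K`
intersect. -/
def Overlap (z : ℂ) : Prop :=
  ∃ a b : ℕ → Bool, a 0 = true ∧ b 0 = false ∧ signSeries z a = signSeries z b

/-- The sequence whose first `n` terms are those of `u`, followed by all the terms of `a`. -/
def splice (n : ℕ) (u a : ℕ → Bool) : ℕ → Bool := fun i => if i < n then u i else a (i - n)

theorem abs_sign (b : Bool) : |sign b| = 1 := by cases b <;> simp [sign]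

theorem norm_sign (b : Bool) : ‖(sign b : ℂ)‖ = 1 := by
  rw [Complex.norm_real, Real.norm_eq_abs, abs_sign]

theorem summable_signSeries {z : ℂ} (hz : ‖z‖ < 1) (a : ℕ → Bool) :
    Summable fun i => (sign (a i) : ℂ) * z ^ i :=
  .of_norm_bounded (summable_geometric_of_lt_one (norm_nonneg z) hz) fun i => by
    rw [norm_mul, norm_sign, one_mul, norm_pow]

theorem signSeries_splice {z : ℂ} (hz : ‖z‖ < 1) (n : ℕ) (u a : ℕ → Bool) :
    signSeries z (splice n u a) =
      ∑ i ∈ Finset.range n, (sign (u i) : ℂ) * z ^ i + z ^ n * signSeries z a := by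
  rw [signSeries, ← (summable_signSeries hz (splice n u a)).sum_add_tsum_nat_add n, signSeries,
    ← tsum_mul_left]
  congr 1
  · refine Finset.sum_congr rfl fun i hi => ?_
    simp [splice, Finset.mem_range.1 hi]
  · refine tsum_congr fun i => ?_
    simp [splice, pow_add]
    ring

theorem splice_self (n : ℕ) (a : ℕ → Bool) : splice n a (fun i => a (i + n)) = a := by
  funext i
  by_cases h : i < n
  · simp [splice, h]
  · simp [splice, h, Nat.sub_add_cancel (not_lt.1 h)]

theorem signSeries_eq {z : ℂ} (hz : ‖z‖ < 1) (a : ℕ → Bool) :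
    signSeries z a = sign (a 0) + z * signSeries z (fun i => a (i + 1)) := by
  conv_lhs => rw [← splice_self 1 a, signSeries_splice hz]
  simp

theorem sign_add_mul_mem_attractor {z : ℂ} (hz : ‖z‖ < 1) (b : Bool) {v : ℂ}
    (hv : v ∈ attractor z) : (sign b : ℂ) + z * v ∈ attractor z := by
  obtain ⟨a, rfl⟩ := hv
  exact ⟨splice 1 (fun _ => b) a, by rw [signSeries_splice hz]; simp⟩

theorem continuousAt_signSeries {z : ℂ} (hz : ‖z‖ < 1) (a : ℕ → Bool) :
    ContinuousAt (fun p : ℂ × (ℕ → Bool) => signSeries p.1 p.2) (z, a) := by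
  obtain ⟨r, hzr, hr⟩ := exists_between hz
  have hs : ContinuousOn (fun p : ℂ × (ℕ → Bool) => signSeries p.1 p.2)
      (Metric.ball 0 r ×ˢ univ) := by
    refine continuousOn_tsum (u := fun i => r ^ i) (fun i => ?_)
      (summable_geometric_of_lt_one ((norm_nonneg z).trans hzr.le) hr) fun i p hp => ?_
    · have : Continuous fun p : ℂ × (ℕ → Bool) => (sign (p.2 i) : ℂ) :=
        (continuous_of_discreteTopology (f := fun b : Bool => (sign b : ℂ))).comp
          ((continuous_apply i).comp continuous_snd)
      exact (this.mul (by fun_prop)).continuousOn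
    · have h : ‖p.1‖ < r := by simpa using hp.1
      rw [norm_mul, norm_sign, one_mul, norm_pow]
      exact pow_le_pow_left₀ (norm_nonneg _) h.le i
  exact hs.continuousAt ((Metric.isOpen_ball.prod isOpen_univ).mem_nhds
    ⟨by simpa using hzr, mem_univ _⟩)

theorem continuous_signSeries {z : ℂ} (hz : ‖z‖ < 1) : Continuous (signSeries z) :=
  continuous_iff_continuousAt.2 fun a =>
    (continuousAt_signSeries hz a).comp (f := fun a => (z, a)) (by fun_prop)

theorem isCompact_attractor {z : ℂ} (hz : ‖z‖ < 1) : IsCompact (attractor z) :=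
  isCompact_range (continuous_signSeries hz)

theorem attractor_nonempty (z : ℂ) : (attractor z).Nonempty := range_nonempty _

/-! ### Connectedness of the attractor and overlap of its pieces -/

/-- If the two pieces of the attractor are at distance at most `δ`, then any two points of the
attractor are connected by a chain with steps at most `δ`. -/
theorem exists_chain {z : ℂ} (hz : ‖z‖ < 1) {δ : ℝ} (hδ : 0 < δ) {a b : ℂ} (ha : a ∈ attractor z)
    (hb : b ∈ attractor z) (hab : dist (1 + z * a) (-1 + z * b) ≤ δ) {x y : ℂ}
    (hx : x ∈ attractor z) (hy : y ∈ attractor z) :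
    Relation.ReflTransGen
      (fun x y => x ∈ attractor z ∧ y ∈ attractor z ∧ dist x y ≤ δ) x y := by
  set D := Metric.diam (attractor z)
  -- Each piece is a copy of the attractor scaled by z, so chains inside a piece have their long
  -- steps shrunk by |z|. One jump of length at most δ between the images of a and b links the
  -- pieces.
  have key : ∀ n : ℕ, ∀ x ∈ attractor z, ∀ y ∈ attractor z, Relation.ReflTransGen
      (fun x y => x ∈ attractor z ∧ y ∈ attractor z ∧ dist x y ≤ max (‖z‖ ^ n * D) δ) x y := by
    intro n
    induction n with
    | zero =>
      intro x hx y hy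
      refine .single ⟨hx, hy, le_max_of_le_left ?_⟩
      rw [pow_zero, one_mul]
      exact Metric.dist_le_diam_of_mem (isCompact_attractor hz).isBounded hx hy
    | succ n ih =>
      have lift : ∀ c : Bool, ∀ x ∈ attractor z, ∀ y ∈ attractor z, Relation.ReflTransGen
          (fun x y => x ∈ attractor z ∧ y ∈ attractor z ∧ dist x y ≤ max (‖z‖ ^ (n + 1) * D) δ)
          (sign c + z * x) (sign c + z * y) := fun c x hx y hy => by
        refine (ih x hx y hy).lift (fun v => (sign c : ℂ) + z * v) ?_
        rintro u v ⟨hu, hv, huv⟩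
        refine ⟨sign_add_mul_mem_attractor hz c hu, sign_add_mul_mem_attractor hz c hv, ?_⟩
        rw [dist_add_left, dist_eq_norm, ← mul_sub, norm_mul, ← dist_eq_norm]
        rcases le_max_iff.1 huv with h | h
        · refine le_max_of_le_left ?_
          rw [pow_succ', mul_assoc]
          gcongr
        · exact le_max_of_le_right ((mul_le_of_le_one_left dist_nonneg hz.le).trans h)
      have h1 : (sign true : ℂ) = 1 := by simp [sign]
      have h2 : (sign false : ℂ) = -1 := by simp [sign]
      have cross : Relation.ReflTransGen
          (fun x y => x ∈ attractor z ∧ y ∈ attractor z ∧ dist x y ≤ max (‖z‖ ^ (n + 1) * D) δ)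
          (sign true + z * a) (sign false + z * b) :=
        .single ⟨sign_add_mul_mem_attractor hz _ ha, sign_add_mul_mem_attractor hz _ hb,
          le_max_of_le_right (by rwa [h1, h2])⟩
      have cross' : Relation.ReflTransGen
          (fun x y => x ∈ attractor z ∧ y ∈ attractor z ∧ dist x y ≤ max (‖z‖ ^ (n + 1) * D) δ)
          (sign false + z * b) (sign true + z * a) :=
        .single ⟨sign_add_mul_mem_attractor hz _ hb, sign_add_mul_mem_attractor hz _ ha,
          le_max_of_le_right (by rwa [h1, h2, dist_comm])⟩
      rintro _ ⟨s, rfl⟩ _ ⟨t, rfl⟩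
      rw [signSeries_eq hz s, signSeries_eq hz t]
      generalize s 0 = c
      generalize t 0 = d
      cases c <;> cases d
      · exact lift _ _ ⟨_, rfl⟩ _ ⟨_, rfl⟩
      · exact ((lift _ _ ⟨_, rfl⟩ _ hb).trans cross').trans (lift _ _ ha _ ⟨_, rfl⟩)
      · exact ((lift _ _ ⟨_, rfl⟩ _ ha).trans cross).trans (lift _ _ hb _ ⟨_, rfl⟩)
      · exact lift _ _ ⟨_, rfl⟩ _ ⟨_, rfl⟩
  have hlim : Tendsto (fun n : ℕ => ‖z‖ ^ n * D) atTop (𝓝 0) := by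
    simpa using (tendsto_pow_atTop_nhds_zero_of_lt_one (norm_nonneg z) hz).mul_const D
  obtain ⟨n, hn⟩ := (hlim.eventually (gt_mem_nhds hδ)).exists
  simpa only [max_eq_right hn.le] using key n x hx y hy

/-- Overlap supplies δ-chains for every δ > 0, while a separation into two compact parts leaves a
positive gap that short steps cannot jump. -/
theorem isConnected_attractor_of_overlap {z : ℂ} (hz : ‖z‖ < 1) (h : Overlap z) :
    IsConnected (attractor z) := by
  obtain ⟨a, b, ha, hb, hab⟩ := h
  refine ⟨attractor_nonempty z, ?_⟩
  rw [isPreconnected_closed_iff]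
  rintro s t hs ht hst ⟨x, hx, hxs⟩ ⟨y, hy, hyt⟩
  by_contra hne
  have hdisj : Disjoint (attractor z ∩ s) (attractor z ∩ t) := by
    rw [Set.disjoint_left]
    exact fun v hv hv' => hne ⟨v, hv.1, hv.2, hv'.2⟩
  obtain ⟨δ, hδ, hd⟩ := hdisj.exists_thickenings ((isCompact_attractor hz).inter_right hs)
    ((isCompact_attractor hz).isClosed.inter ht)
  rw [signSeries_eq hz a, signSeries_eq hz b, ha, hb] at hab
  have hab' : dist (1 + z * signSeries z fun i => a (i + 1))
      (-1 + z * signSeries z fun i => b (i + 1)) ≤ δ / 2 := by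
    simp only [sign] at hab
    simp at hab
    rw [hab]
    simpa using (half_pos hδ).le
  have hch := exists_chain hz (half_pos hδ) ⟨_, rfl⟩ ⟨_, rfl⟩ hab' hx hy
  have hstay : ∀ v, Relation.ReflTransGen (fun x y => x ∈ attractor z ∧ y ∈ attractor z ∧
      dist x y ≤ δ / 2) x v → v ∈ attractor z ∩ s := by
    intro v hv
    induction hv with
    | refl => exact ⟨hx, hxs⟩
    | tail _ h ih =>
      obtain ⟨h1, h2, h3⟩ := h
      refine ⟨h2, (hst h2).resolve_right fun h4 => ?_⟩
      refine Set.disjoint_left.1 hd (Metric.mem_thickening_iff.2 ⟨_, ih, ?_⟩)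
        (Metric.self_subset_thickening hδ _ ⟨h2, h4⟩)
      rw [dist_comm]
      linarith
  exact hne ⟨y, hy, (hstay y hch).2, hyt⟩

theorem overlap_of_isConnected_attractor {z : ℂ} (hz : ‖z‖ < 1) (h : IsConnected (attractor z)) :
    Overlap z := by
  have hcl : ∀ c : Bool, IsClosed ((fun v => (sign c : ℂ) + z * v) '' attractor z) := fun c =>
    ((isCompact_attractor hz).image (by fun_prop)).isClosed
  obtain ⟨v, -, ⟨_, ⟨a, rfl⟩, ha⟩, _, ⟨b, rfl⟩, hb⟩ :=
    isPreconnected_closed_iff.1 h.2 _ _ (hcl true) (hcl false) (by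
      rintro _ ⟨a, rfl⟩
      rw [signSeries_eq hz]
      cases a 0
      · exact .inr ⟨_, ⟨_, rfl⟩, rfl⟩
      · exact .inl ⟨_, ⟨_, rfl⟩, rfl⟩)
      (by
        obtain ⟨v, hv⟩ := attractor_nonempty z
        exact ⟨_, sign_add_mul_mem_attractor hz true hv, v, hv, rfl⟩)
      (by
        obtain ⟨v, hv⟩ := attractor_nonempty z
        exact ⟨_, sign_add_mul_mem_attractor hz false hv, v, hv, rfl⟩)
  refine ⟨splice 1 (fun _ => true) a, splice 1 (fun _ => false) b, rfl, rfl, ?_⟩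
  rw [signSeries_splice hz, signSeries_splice hz]
  simpa using ha.trans hb.symm

/-! ### The limit set as an affine image, and closedness of the locus -/

/-- The affine map carrying the attractor of `v ↦ ±1 + z v` to the limit set of `G_z`. -/
noncomputable def toLimitSet (z v : ℂ) : ℂ := 1 / 2 + (1 - z) / 2 * v

theorem similarity_one_toLimitSet (z v : ℂ) :
    similarity z 1 (toLimitSet z v) = toLimitSet z (1 + z * v) := by
  simp only [similarity, toLimitSet]; ring

theorem similarity_zero_toLimitSet (z v : ℂ) :
    similarity z 0 (toLimitSet z v) = toLimitSet z (-1 + z * v) := by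
  simp only [similarity, toLimitSet]; ring

theorem exists_affine_of_mem_semigroup {z : ℂ} (hz : ‖z‖ < 1) {h : Function.End ℂ}
    (hh : h ∈ semigroup z) : ∃ c κ : ℂ, ‖κ‖ < 1 ∧ (∀ v ∈ attractor z, c + κ * v ∈ attractor z) ∧
      ∀ v, h (toLimitSet z v) = toLimitSet z (c + κ * v) := by
  induction hh using Subsemigroup.closure_induction with
  | mem h hh =>
    rcases hh with rfl | rfl
    · exact ⟨-1, z, hz, fun v hv => by simpa [sign] using sign_add_mul_mem_attractor hz false hv,
        similarity_zero_toLimitSet z⟩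
    · exact ⟨1, z, hz, fun v hv => by simpa [sign] using sign_add_mul_mem_attractor hz true hv,
        similarity_one_toLimitSet z⟩
  | mul f g _ _ hf hg =>
    obtain ⟨c, κ, hκ, hK, hf⟩ := hf
    obtain ⟨d, μ, hμ, hK', hg⟩ := hg
    refine ⟨c + κ * d, κ * μ, ?_, fun v hv => ?_, fun v => ?_⟩
    · rw [norm_mul]
      exact mul_lt_one_of_nonneg_of_lt_one_left (norm_nonneg _) hκ hμ.le
    · convert hK _ (hK' v hv) using 1
      ring
    · change f (g _) = _
      rw [hg, hf]
      congr 1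
      ring

theorem exists_mem_semigroup (z : ℂ) (u : ℕ → Bool) (n : ℕ) : ∃ h ∈ semigroup z, ∀ v,
    h (toLimitSet z v) =
      toLimitSet z (∑ i ∈ Finset.range (n + 1), (sign (u i) : ℂ) * z ^ i + z ^ (n + 1) * v) := by
  have hs : ∀ b : Bool, ∃ h ∈ semigroup z, ∀ v,
      h (toLimitSet z v) = toLimitSet z (sign b + z * v) := fun b => by
    cases b
    · exact ⟨_, Subsemigroup.subset_closure (Or.inl rfl), fun v => by
        rw [similarity_zero_toLimitSet]; simp [sign]⟩
    · exact ⟨_, Subsemigroup.subset_closure (Or.inr rfl), fun v => by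
        rw [similarity_one_toLimitSet]; simp [sign]⟩
  induction n with
  | zero => simpa using hs (u 0)
  | succ n ih =>
    obtain ⟨h, hh, hv⟩ := ih
    obtain ⟨g, hg, hw⟩ := hs (u (n + 1))
    refine ⟨h * g, mul_mem hh hg, fun v => ?_⟩
    change h (g _) = _
    rw [hw, hv, Finset.sum_range_succ _ (n + 1)]
    congr 1
    ring

/-- Each element of the semigroup is conjugate to a contraction preserving the compact attractor, so
its fixed point is a limit of orbit points there. Conversely, the word of the first n + 1 signs has
fixed point S n / (1 − z^(n+1)), which tends to the value of the series. -/
theorem limitSet_semigroup {z : ℂ} (hz : ‖z‖ < 1) :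
    limitSet (semigroup z) = toLimitSet z '' attractor z := by
  have hz1 : 1 - z ≠ 0 := fun h => by
    rw [← sub_eq_zero.1 h] at hz
    simp at hz
  have hT : Continuous (toLimitSet z) := by unfold toLimitSet; fun_prop
  have hinj : Function.Injective (toLimitSet z) := fun v w h => by
    simpa [toLimitSet, hz1] using h
  apply Subset.antisymm
  · refine closure_minimal ?_ ((isCompact_attractor hz).image hT).isClosed
    rintro x ⟨h, hh, hx⟩
    obtain ⟨c, κ, hκ, hK, hv⟩ := exists_affine_of_mem_semigroup hz hh
    obtain ⟨v, rfl⟩ : ∃ v, toLimitSet z v = x :=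
      ⟨2 / (1 - z) * (x - 1 / 2), by simp only [toLimitSet]; field_simp; ring⟩
    refine ⟨v, ?_, rfl⟩
    have hfix : c + κ * v = v := hinj ((hv v).symm.trans hx)
    obtain ⟨w, hw⟩ := attractor_nonempty z
    have hmem : ∀ k : ℕ, v + κ ^ k * (w - v) ∈ attractor z := by
      intro k
      induction k with
      | zero => simpa using hw
      | succ k ih =>
        convert hK _ ih using 1
        linear_combination -hfix
    refine (isCompact_attractor hz).isClosed.mem_of_tendsto (b := atTop) ?_
      (Eventually.of_forall hmem)
    simpa using ((tendsto_pow_atTop_nhds_zero_of_norm_lt_one hκ).mul_const (w - v)).const_add v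
  · rintro _ ⟨_, ⟨a, rfl⟩, rfl⟩
    set S : ℕ → ℂ := fun n => ∑ i ∈ Finset.range (n + 1), (sign (a i) : ℂ) * z ^ i with hS
    have hS' : Tendsto S atTop (𝓝 (signSeries z a)) :=
      (summable_signSeries hz a).hasSum.tendsto_sum_nat.comp (tendsto_add_atTop_nat 1)
    have hpow : Tendsto (fun n : ℕ => 1 - z ^ (n + 1)) atTop (𝓝 1) := by
      simpa using ((tendsto_pow_atTop_nhds_zero_of_norm_lt_one hz).comp
        (tendsto_add_atTop_nat 1)).const_sub 1
    have hlim : Tendsto (fun n => S n / (1 - z ^ (n + 1))) atTop (𝓝 (signSeries z a)) := by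
      rw [← div_one (signSeries z a)]
      exact hS'.div hpow one_ne_zero
    refine mem_closure_of_tendsto ((hT.tendsto _).comp hlim) (Eventually.of_forall fun n => ?_)
    obtain ⟨h, hh, hv⟩ := exists_mem_semigroup z a n
    refine ⟨h, hh, ?_⟩
    have hne : 1 - z ^ (n + 1) ≠ 0 := fun h0 => by
      have := pow_lt_one₀ (norm_nonneg z) hz n.succ_ne_zero
      rw [← norm_pow, ← sub_eq_zero.1 h0] at this
      simp at this
    change h (toLimitSet z (S n / (1 - z ^ (n + 1)))) = toLimitSet z (S n / (1 - z ^ (n + 1)))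
    rw [hv]
    congr 1
    change S n + _ = _
    field_simp
    ring

theorem mem_connectednessLocus_iff (z : PuncturedDisk) :
    z ∈ connectednessLocus ↔ Overlap (z : ℂ) := by
  have hz := z.2.2
  have hz1 : (1 - (z : ℂ)) / 2 ≠ 0 := by
    refine div_ne_zero (fun h => ?_) two_ne_zero
    rw [← sub_eq_zero.1 h] at hz
    simp at hz
  change IsConnected _ ↔ _
  have : toLimitSet (z : ℂ) =
      (Homeomorph.mulLeft₀ _ hz1).trans (Homeomorph.addLeft (1 / 2)) := by
    funext v; simp [toLimitSet]
  rw [limitSet_semigroup hz, this, Homeomorph.isConnected_image]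
  exact ⟨overlap_of_isConnected_attractor hz, isConnected_attractor_of_overlap hz⟩

/-- The locus is the projection of a closed incidence set along the compact space of coefficient
pairs. -/
theorem isClosed_connectednessLocus : IsClosed connectednessLocus := by
  have hcont : ∀ f : (ℕ → Bool) × (ℕ → Bool) → (ℕ → Bool), Continuous f →
      Continuous fun p : PuncturedDisk × ((ℕ → Bool) × (ℕ → Bool)) =>
        signSeries (p.1 : ℂ) (f p.2) := fun f hf =>
    continuous_iff_continuousAt.2 fun p =>
      (continuousAt_signSeries p.1.2.2 (f p.2)).comp
        (f := fun p : PuncturedDisk × ((ℕ → Bool) × (ℕ → Bool)) => ((p.1 : ℂ), f p.2))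
        (by fun_prop)
  have hcl : IsClosed {p : PuncturedDisk × ((ℕ → Bool) × (ℕ → Bool)) |
      p.2.1 0 = true ∧ p.2.2 0 = false ∧
        signSeries (p.1 : ℂ) p.2.1 = signSeries (p.1 : ℂ) p.2.2} :=
    (isClosed_eq (by fun_prop) continuous_const).inter
      ((isClosed_eq (by fun_prop) continuous_const).inter
        (isClosed_eq (hcont _ continuous_fst) (hcont _ continuous_snd)))
  convert isClosedMap_fst_of_compactSpace _ hcl
  ext z
  rw [mem_connectednessLocus_iff]
  constructor
  · rintro ⟨a, b, h⟩
    exact ⟨(z, a, b), h, rfl⟩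
  · rintro ⟨⟨_, a, b⟩, h, rfl⟩
    exact ⟨a, b, h⟩

/-! ### Gap between the pieces and the area bound -/

/-- If the two pieces of the attractor are disjoint, their distance is positive and attained. -/
theorem exists_gap {z : ℂ} (hz : ‖z‖ < 1) (h : ¬ Overlap z) : ∃ δ > 0,
    (∃ a ∈ attractor z, ∃ b ∈ attractor z, dist (1 + z * a) (-1 + z * b) = δ) ∧
      ∀ a ∈ attractor z, ∀ b ∈ attractor z, δ ≤ dist (1 + z * a) (-1 + z * b) := by
  obtain ⟨⟨_, _⟩, ⟨⟨a, rfl⟩, ⟨b, rfl⟩⟩, hmin⟩ :=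
    ((isCompact_attractor hz).prod (isCompact_attractor hz)).exists_isMinOn
      ((attractor_nonempty z).prod (attractor_nonempty z))
      (f := fun p : ℂ × ℂ => dist (1 + z * p.1) (-1 + z * p.2)) (by fun_prop)
  refine ⟨_, dist_pos.2 fun heq => h ?_, ⟨_, ⟨a, rfl⟩, _, ⟨b, rfl⟩, rfl⟩,
    fun u hu v hv => hmin (⟨hu, hv⟩ : (u, v) ∈ attractor z ×ˢ attractor z)⟩
  refine ⟨splice 1 (fun _ => true) a, splice 1 (fun _ => false) b, rfl, rfl, ?_⟩
  rw [signSeries_splice hz, signSeries_splice hz]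
  simpa [sign] using heq

theorem volume_image_add_mul (c z : ℂ) (s : Set ℂ) :
    MeasureTheory.volume ((fun v => c + z * v) '' s) =
      ENNReal.ofReal (‖z‖ ^ 2) * MeasureTheory.volume s := by
  have h1 : (fun v => c + z * v) '' s = (fun v => c + v) '' (LinearMap.mulLeft ℝ z '' s) := by
    rw [image_image]
    rfl
  rw [h1, image_add_left, MeasureTheory.measure_preimage_add,
    MeasureTheory.Measure.addHaar_image_linearMap]
  congr 2
  have : LinearMap.det (LinearMap.mulLeft ℝ z) = ‖z‖ ^ 2 := by
    rw [← Complex.normSq_eq_norm_sq, ← Algebra.norm_complex_apply]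
    rfl
  rw [this, abs_of_nonneg (by positivity)]

/-- Disjoint pieces would put two disjoint copies of N, each of area |z|² times that of N, inside N.
A thickening replaces the attractor because its area is certainly positive. -/
theorem overlap_of_half_lt {z : ℂ} (hz : ‖z‖ < 1) (h : 1 / 2 < ‖z‖ ^ 2) : Overlap z := by
  by_contra hno
  obtain ⟨δ, hδ, -, hgap⟩ := exists_gap hz hno
  set N := Metric.thickening (δ / 2) (attractor z) with hN
  have hdisj : Disjoint ((fun v => (1 : ℂ) + z * v) '' N) ((fun v => (-1 : ℂ) + z * v) '' N) := by
    rw [Set.disjoint_left]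
    rintro _ ⟨u, hu, rfl⟩ ⟨v, hv, huv⟩
    obtain ⟨a, ha, hua⟩ := Metric.mem_thickening_iff.1 hu
    obtain ⟨b, hb, hvb⟩ := Metric.mem_thickening_iff.1 hv
    have key : dist (1 + z * a) (-1 + z * b) ≤ ‖z‖ * dist u a + ‖z‖ * dist v b := by
      rw [dist_eq_norm, dist_eq_norm, dist_eq_norm, ← norm_mul, ← norm_mul]
      have : 1 + z * a - (-1 + z * b) = -(z * (u - a)) + z * (v - b) := by
        linear_combination -huv
      rw [this]
      exact (norm_add_le _ _).trans_eq (by rw [norm_neg])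
    nlinarith [hgap a ha b hb, mul_le_of_le_one_left (dist_nonneg (x := u) (y := a)) hz.le,
      mul_le_of_le_one_left (dist_nonneg (x := v) (y := b)) hz.le]
  have hsub : ∀ c : Bool, (fun v => (sign c : ℂ) + z * v) '' N ⊆ N := by
    rintro c _ ⟨u, hu, rfl⟩
    obtain ⟨a, ha, hua⟩ := Metric.mem_thickening_iff.1 hu
    refine Metric.mem_thickening_iff.2 ⟨_, sign_add_mul_mem_attractor hz c ha, ?_⟩
    rw [dist_add_left, dist_eq_norm, ← mul_sub, norm_mul, ← dist_eq_norm]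
    exact (mul_le_of_le_one_left dist_nonneg hz.le).trans_lt hua
  have hopen : IsOpen N := Metric.isOpen_thickening
  have hle : MeasureTheory.volume ((fun v => (1 : ℂ) + z * v) '' N) +
      MeasureTheory.volume ((fun v => (-1 : ℂ) + z * v) '' N) ≤ MeasureTheory.volume N := by
    rw [← MeasureTheory.measure_union hdisj]
    · refine MeasureTheory.measure_mono (union_subset ?_ ?_)
      · simpa [sign] using hsub true
      · simpa [sign] using hsub false
    · have hz0 : z ≠ 0 := fun h0 => by norm_num [h0] at h
      have : (fun v => (-1 : ℂ) + z * v) =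
          (Homeomorph.mulLeft₀ z hz0).trans (Homeomorph.addLeft (-1)) := by
        funext v; simp
      rw [this]
      exact ((Homeomorph.isOpenMap _) _ hopen).measurableSet
  rw [volume_image_add_mul, volume_image_add_mul, ← add_mul,
    ← ENNReal.ofReal_add (by positivity) (by positivity)] at hle
  have hpos : MeasureTheory.volume N ≠ 0 :=
    (hopen.measure_pos _ ((attractor_nonempty z).mono
      (Metric.self_subset_thickening (half_pos hδ) _))).ne'
  have hfin : MeasureTheory.volume N ≠ ⊤ :=
    ((isCompact_attractor hz).isBounded.thickening).measure_lt_top.ne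
  have h1 : ENNReal.ofReal (‖z‖ ^ 2 + ‖z‖ ^ 2) ≤ 1 := by
    rwa [← ENNReal.mul_le_mul_iff_left hpos hfin, one_mul]
  rw [ENNReal.ofReal_le_one] at h1
  linarith

/-! ### Forced approach of a chain-connected set and its translate -/

/-- A `δ`-chain in a set gives a path in its thickening. -/
theorem joinedIn_thickening_of_chain {K : Set ℂ} {δ : ℝ} (hδ : 0 < δ) {x y : ℂ} (hx : x ∈ K)
    (h : Relation.ReflTransGen (fun x y => x ∈ K ∧ y ∈ K ∧ dist x y ≤ δ) x y) {ρ : ℝ}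
    (hρ : δ / 2 < ρ) : JoinedIn (Metric.thickening ρ K) x y := by
  induction h with
  | refl => exact JoinedIn.refl (Metric.self_subset_thickening (by linarith) _ hx)
  | tail _ h ih =>
    rename_i u v _
    obtain ⟨hu, hv, huv⟩ := h
    refine ih.trans (JoinedIn.of_segment_subset fun p hp => ?_)
    have hsum := dist_add_dist_of_mem_segment hp
    rw [Metric.mem_thickening_iff]
    by_cases hup : dist u p ≤ δ / 2
    · exact ⟨u, hu, by rw [dist_comm]; linarith⟩
    · exact ⟨v, hv, by linarith⟩

/-- If the chain-connected set `K` contains points `p`, `q` and suitable vertical rays are disjoint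
from `K`, then `K` and its translate by `w` approach each other. -/
theorem exists_dist_add_lt_of_rays {K : Set ℂ} {δ ρ : ℝ} (hδ : 0 < δ) (hρ : δ / 2 < ρ)
    (hK : ∀ x ∈ K, ∀ y ∈ K,
      Relation.ReflTransGen (fun x y => x ∈ K ∧ y ∈ K ∧ dist x y ≤ δ) x y)
    {p q w : ℂ} (hp : p ∈ K) (hq : q ∈ K) (hw : w.re < 0) (hpq : p.re < (q + w).re)
    (h1 : ∀ k ∈ K, ∀ τ : ℝ, 0 ≤ τ → ρ ≤ dist k (p + w + τ * Complex.I))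
    (h2 : ∀ k ∈ K, ∀ τ : ℝ, 0 ≤ τ → ρ ≤ dist k (q + w + τ * Complex.I))
    (h3 : ∀ k ∈ K, ∀ τ : ℝ, 0 ≤ τ → ρ ≤ dist k (p - w + τ * Complex.I))
    (h4 : ∀ k ∈ K, ∀ τ : ℝ, 0 ≤ τ → ρ ≤ dist k (q - w + τ * Complex.I)) :
    ∃ k ∈ K, ∃ l ∈ K, dist k (l + w) < 2 * ρ := by
  obtain ⟨γ, hγ⟩ := joinedIn_thickening_of_chain hδ hp (hK p hp q hq) hρ
  have hfar : ∀ c : ℂ, (∀ k ∈ K, ∀ τ : ℝ, 0 ≤ τ → ρ ≤ dist k (c + τ * Complex.I)) →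
      ∀ s, ∀ τ : ℝ, 0 ≤ τ → γ s ≠ c + τ * Complex.I := by
    intro c hc s τ hτ heq
    obtain ⟨k, hk, hd⟩ := Metric.mem_thickening_iff.1 (hγ s)
    rw [heq, dist_comm] at hd
    exact absurd (hc k hk τ hτ) hd.not_ge
  have hmap : Continuous fun v => v + w := by fun_prop
  -- The second path is the translate of the first by w, so its avoiding the rays from p and q means
  -- that γ avoids the rays from p − w and q − w.
  obtain ⟨s, t, hst⟩ := exists_eq_of_alternating_endpoints γ (γ.map hmap) (hfar _ h1) (hfar _ h2)
    (fun t τ hτ heq => hfar _ h3 t τ hτ (by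
      simp only [Path.map_coe, Function.comp_apply] at heq
      linear_combination heq))
    (fun t τ hτ heq => hfar _ h4 t τ hτ (by
      simp only [Path.map_coe, Function.comp_apply] at heq
      linear_combination heq))
    (by simpa using hw) hpq (by simpa using hw)
  obtain ⟨k, hk, hk'⟩ := Metric.mem_thickening_iff.1 (hγ s)
  obtain ⟨l, hl, hl'⟩ := Metric.mem_thickening_iff.1 (hγ t)
  refine ⟨k, hk, l, hl, ?_⟩
  simp only [Path.map_coe, Function.comp_apply] at hst
  calc dist k (l + w) ≤ dist k (γ s) + dist (γ s) (l + w) := dist_triangle _ _ _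
    _ < 2 * ρ := by
      rw [dist_comm] at hk'
      have : dist (γ s) (l + w) = dist (γ t) l := by rw [hst, dist_add_right]
      linarith

end SchottkySemigroup

/-! ### The top side of the convex hull -/

/-- Pair the indices 2k + 2 and 2k + 3: each pair has at most one nonzero term, so the tail is at
most r²/(1 − r²) < 1 = |x 0|. -/
theorem tsum_ne_zero_of_eq_zero_or_succ_eq_zero {x : ℕ → ℝ} {r : ℝ} (hr0 : 0 ≤ r)
    (hr : r ^ 2 < 1 / 2) (h0 : |x 0| = 1) (h1 : x 1 = 0) (hb : ∀ i, |x i| ≤ r ^ i)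
    (hx : ∀ i, x i = 0 ∨ x (i + 1) = 0) : ∑' i, x i ≠ 0 := by
  have hr1 : r < 1 := by nlinarith
  have hs : Summable x := .of_norm_bounded (summable_geometric_of_lt_one hr0 hr1) hb
  have hs2 : Summable fun i => x (i + 2) := (summable_nat_add_iff 2).2 hs
  have he : Summable fun k => x (2 * k + 2) :=
    hs2.comp_injective (i := fun k => 2 * k) fun a b h => by simpa using h
  have ho : Summable fun k => x (2 * k + 1 + 2) :=
    hs2.comp_injective (i := fun k => 2 * k + 1) fun a b h => by simpa using h
  have hsum : ∑' i, x i = x 0 + ∑' k, (x (2 * k + 2) + x (2 * k + 1 + 2)) := by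
    rw [← hs.sum_add_tsum_nat_add 2, ← tsum_even_add_odd (f := fun i => x (i + 2)) he ho,
      he.tsum_add ho]
    simp [Finset.sum_range_succ, h1]
  have hpair : ∀ k, ‖x (2 * k + 2) + x (2 * k + 1 + 2)‖ ≤ r ^ 2 * (r ^ 2) ^ k := by
    intro k
    rw [← pow_mul, ← pow_add, Real.norm_eq_abs]
    rcases hx (2 * k + 2) with h | h
    · rw [h, zero_add]
      exact (hb _).trans (pow_le_pow_of_le_one hr0 hr1.le (by omega))
    · rw [show 2 * k + 1 + 2 = 2 * k + 2 + 1 by ring, h, add_zero]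
      exact (hb _).trans (pow_le_pow_of_le_one hr0 hr1.le (by omega))
  have hgeo := (hasSum_geometric_of_lt_one (sq_nonneg r) (by linarith)).mul_left (r ^ 2)
  have hle := tsum_of_norm_bounded hgeo hpair
  have hlt : r ^ 2 * (1 - r ^ 2)⁻¹ < 1 := by
    rw [← div_eq_mul_inv, div_lt_one (by linarith)]
    linarith
  intro h
  rw [hsum, add_eq_zero_iff_eq_neg] at h
  rw [h, abs_neg] at h0
  rw [Real.norm_eq_abs] at hle
  linarith

namespace SchottkySemigroup

theorem hasSum_re_signSeries {z : ℂ} (hz : ‖z‖ < 1) (a : ℕ → Bool) :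
    HasSum (fun i => sign (a i) * (z ^ i).re) (signSeries z a).re := by
  simpa [signSeries] using Complex.hasSum_re (summable_signSeries hz a).hasSum

theorem hasSum_im_signSeries {z : ℂ} (hz : ‖z‖ < 1) (a : ℕ → Bool) :
    HasSum (fun i => sign (a i) * (z ^ i).im) (signSeries z a).im := by
  simpa [signSeries] using Complex.hasSum_im (summable_signSeries hz a).hasSum

/-- The coefficients of the rightmost (`s = true`) and the leftmost (`s = false`) among the highest
points of the attractor. -/
noncomputable def topSigns (z : ℂ) (s : Bool) (i : ℕ) : Bool :=
  if (z ^ i).im = 0 then (if 0 < (z ^ i).re then s else !s) else decide (0 < (z ^ i).im)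

theorem sign_topSigns_mul_im (z : ℂ) (s : Bool) (i : ℕ) :
    sign (topSigns z s i) * (z ^ i).im = |(z ^ i).im| := by
  by_cases h : (z ^ i).im = 0
  · simp [h]
  · rcases lt_or_gt_of_ne h with h' | h'
    · simp [topSigns, h, sign, abs_of_neg h', not_lt.2 h'.le]
    · simp [topSigns, h, sign, h', abs_of_pos h']

theorem sign_topSigns_mul_re {z : ℂ} {i : ℕ} (h : (z ^ i).im = 0) (s : Bool) :
    sign (topSigns z s i) * (z ^ i).re = sign s * |(z ^ i).re| := by
  by_cases h' : 0 < (z ^ i).re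
  · simp [topSigns, h, h', abs_of_pos h']
  · cases s <;> simp [topSigns, h, h', sign, abs_of_nonpos (not_lt.1 h')]

theorem sign_mul_le_abs (b : Bool) (x : ℝ) : sign b * x ≤ |x| := by
  cases b
  · simpa [sign] using neg_le_abs x
  · simpa [sign] using le_abs_self x

theorem im_signSeries_topSigns {z : ℂ} (hz : ‖z‖ < 1) (s : Bool) :
    (signSeries z (topSigns z s)).im = ∑' i, |(z ^ i).im| := by
  rw [← (hasSum_im_signSeries hz _).tsum_eq]
  simp only [sign_topSigns_mul_im]

/-- A highest point of the attractor has the same coefficients as `topSigns` wherever the power of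
`z` is not real. -/
theorem eq_topSigns_of_im_le {z : ℂ} (hz : ‖z‖ < 1) {c : ℕ → Bool} (s : Bool)
    (hc : (signSeries z (topSigns z s)).im ≤ (signSeries z c).im) {i : ℕ} (hi : (z ^ i).im ≠ 0) :
    sign (c i) = sign (topSigns z s i) := by
  have hsum := (hasSum_im_signSeries hz (topSigns z s)).sub (hasSum_im_signSeries hz c)
  simp only [sign_topSigns_mul_im] at hsum
  have hnn : ∀ i, 0 ≤ |(z ^ i).im| - sign (c i) * (z ^ i).im := fun i =>
    sub_nonneg.2 (sign_mul_le_abs _ _)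
  have h0 : (signSeries z (topSigns z s)).im - (signSeries z c).im = 0 :=
    le_antisymm (sub_nonpos.2 hc) (hsum.nonneg hnn)
  rw [h0, hasSum_zero_iff_of_nonneg hnn] at hsum
  have := congrFun hsum i
  simp only [Pi.zero_apply] at this
  rw [← sign_topSigns_mul_im z s, ← sub_mul] at this
  exact (sub_eq_zero.1 ((mul_eq_zero.1 this).resolve_right hi)).symm

theorem re_signSeries_topSigns_lt {z : ℂ} (hz : ‖z‖ < 1) :
    (signSeries z (topSigns z false)).re < (signSeries z (topSigns z true)).re := by
  have hsum := (hasSum_re_signSeries hz (topSigns z true)).sub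
    (hasSum_re_signSeries hz (topSigns z false))
  rw [← sub_pos]
  refine lt_of_lt_of_le (b := 2) two_pos ?_
  have hnn : ∀ i, 0 ≤ sign (topSigns z true i) * (z ^ i).re -
      sign (topSigns z false i) * (z ^ i).re := by
    intro i
    by_cases hi : (z ^ i).im = 0
    · rw [sign_topSigns_mul_re hi, sign_topSigns_mul_re hi]
      simp only [sign]
      simp
    · simp [topSigns, hi]
  refine le_trans (le_of_eq ?_) (le_hasSum hsum 0 fun i _ => hnn i)
  rw [sign_topSigns_mul_re (by simp), sign_topSigns_mul_re (by simp)]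
  norm_num [sign]

/-- A highest point can deviate from `topSigns` only where the power of z is real, and there the two
choices of `topSigns` are extremal. -/
theorem re_signSeries_mem_Icc_of_im_le {z : ℂ} (hz : ‖z‖ < 1) {c : ℕ → Bool}
    (hc : (signSeries z (topSigns z true)).im ≤ (signSeries z c).im) :
    (signSeries z c).re ∈
      Icc (signSeries z (topSigns z false)).re (signSeries z (topSigns z true)).re := by
  have hc' : (signSeries z (topSigns z false)).im ≤ (signSeries z c).im := by
    rwa [im_signSeries_topSigns hz] at hc ⊢
  constructor
  · refine hasSum_le (fun i => ?_) (hasSum_re_signSeries hz _) (hasSum_re_signSeries hz _)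
    by_cases hi : (z ^ i).im = 0
    · rw [sign_topSigns_mul_re hi]
      have := abs_le.1 ((abs_mul (sign (c i)) (z ^ i).re).trans_le
        (by rw [abs_sign, one_mul]))
      simpa [sign] using this.1
    · rw [eq_topSigns_of_im_le hz false hc' hi]
  · refine hasSum_le (fun i => ?_) (hasSum_re_signSeries hz _) (hasSum_re_signSeries hz _)
    by_cases hi : (z ^ i).im = 0
    · rw [sign_topSigns_mul_re hi]
      simpa [sign] using sign_mul_le_abs (c i) (z ^ i).re
    · rw [eq_topSigns_of_im_le hz true hc hi]

/-- The midpoint of the top side of the convex hull of the attractor is in a gap of the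
attractor. -/
theorem two_mul_re_signSeries_ne_of_im_le {z : ℂ} (hz0 : z.im ≠ 0) (hz : ‖z‖ ^ 2 < 1 / 2)
    {c : ℕ → Bool} (hc : (signSeries z (topSigns z true)).im ≤ (signSeries z c).im) :
    2 * (signSeries z c).re ≠
      (signSeries z (topSigns z false)).re + (signSeries z (topSigns z true)).re := by
  have hz1 : ‖z‖ < 1 := by nlinarith [norm_nonneg z]
  have hc' : (signSeries z (topSigns z false)).im ≤ (signSeries z c).im := by
    rwa [im_signSeries_topSigns hz1] at hc ⊢
  -- The offset of the point from the midpoint is the sum of x: nonreal powers cancel, and at real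
  -- powers the two extreme choices average to 0. Two consecutive powers of a nonreal z cannot both
  -- contribute.
  set x : ℕ → ℝ := fun i => if (z ^ i).im = 0 then sign (c i) * (z ^ i).re else 0 with hx
  have hsum := (((hasSum_re_signSeries hz1 c).mul_left 2).sub
    ((hasSum_re_signSeries hz1 (topSigns z false)).add
      (hasSum_re_signSeries hz1 (topSigns z true)))).div_const 2
  have hterm : (fun i => (2 * (sign (c i) * (z ^ i).re) -
      (sign (topSigns z false i) * (z ^ i).re + sign (topSigns z true i) * (z ^ i).re)) / 2)
      = x := by
    funext i
    by_cases hi : (z ^ i).im = 0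
    · rw [sign_topSigns_mul_re hi, sign_topSigns_mul_re hi]
      have ht : sign true = 1 := by simp [sign]
      have hf : sign false = -1 := by simp [sign]
      simp only [hx, hi, if_true, ht, hf]
      ring
    · rw [← eq_topSigns_of_im_le hz1 false hc' hi, ← eq_topSigns_of_im_le hz1 true hc hi]
      simp [hx, hi]
      ring
  rw [hterm] at hsum
  intro h
  refine tsum_ne_zero_of_eq_zero_or_succ_eq_zero (x := x) (norm_nonneg z) hz ?_ ?_ ?_ ?_ ?_
  · simp [hx, abs_sign]
  · simp [hx, hz0]
  · intro i
    by_cases hi : (z ^ i).im = 0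
    · simp only [hx, hi, if_true]
      rw [abs_mul, abs_sign, one_mul, ← norm_pow]
      exact Complex.abs_re_le_norm _
    · simp [hx, hi]
  · intro i
    by_contra! hcon
    have h1 : (z ^ i).im = 0 := by
      by_contra hi
      exact hcon.1 (by simp [hx, hi])
    have h2 : (z ^ (i + 1)).im = 0 := by
      by_contra hi
      exact hcon.2 (by simp [hx, hi])
    rw [pow_succ, Complex.mul_im, h1, zero_mul, add_zero] at h2
    have h3 := (mul_eq_zero.1 h2).resolve_right hz0
    exact hcon.1 (by simp [hx, h3])
  · rw [hsum.tsum_eq, h]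
    simp

/-- Avoiding an upward vertical ray is stable under perturbation of the parameter and the ray. -/
theorem exists_eventually_le_dist_ray {X : Type*} [TopologicalSpace X] {x₀ : X} {f g : X → ℂ}
    (hf : ContinuousAt f x₀) (hf1 : ‖f x₀‖ < 1) (hg : ContinuousAt g x₀)
    (h : ∀ c, (signSeries (f x₀) c).re = (g x₀).re → (signSeries (f x₀) c).im < (g x₀).im) :
    ∃ ρ > 0, ∀ᶠ x in 𝓝 x₀, ∀ k ∈ attractor (f x), ∀ τ : ℝ, 0 ≤ τ →
      ρ ≤ dist k (g x + τ * Complex.I) := by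
  set R : Set ℂ := {u | u.re = 0 ∧ 0 ≤ u.im} with hR
  have hRc : IsClosed R := (isClosed_eq Complex.continuous_re continuous_const).inter
    (isClosed_le continuous_const Complex.continuous_im)
  have hRn : R.Nonempty := ⟨0, by simp [hR]⟩
  have hpos : ∀ c, 0 < Metric.infDist (signSeries (f x₀) c - g x₀) R := fun c => by
    refine (hRc.notMem_iff_infDist_pos hRn).1 fun hmem => ?_
    have h1 : (signSeries (f x₀) c).re = (g x₀).re := sub_eq_zero.1 (by simpa using hmem.1)
    have h2 : (g x₀).im ≤ (signSeries (f x₀) c).im := sub_nonneg.1 (by simpa using hmem.2)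
    exact (h c h1).not_ge h2
  obtain ⟨c₀, -, hmin⟩ := (isCompact_univ (X := ℕ → Bool)).exists_isMinOn univ_nonempty
    (f := fun c => Metric.infDist (signSeries (f x₀) c - g x₀) R)
    ((Metric.continuous_infDist_pt R).comp
      ((continuous_signSeries hf1).sub continuous_const)).continuousOn
  set ρ := Metric.infDist (signSeries (f x₀) c₀ - g x₀) R
  refine ⟨ρ / 2, half_pos (hpos c₀), ?_⟩
  -- Compactness of the coefficient space makes the bound uniform; halving ρ leaves room for the
  -- perturbation.
  have hev : ∀ᶠ x in 𝓝 x₀, ∀ c ∈ (univ : Set (ℕ → Bool)),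
      ρ / 2 < Metric.infDist (signSeries (f x) c - g x) R := by
    refine isCompact_univ.eventually_forall_of_forall_eventually fun c _ => ?_
    have hcont : ContinuousAt (fun v : X × (ℕ → Bool) =>
        Metric.infDist (signSeries (f v.1) v.2 - g v.1) R) (x₀, c) := by
      refine (Metric.continuous_infDist_pt R).continuousAt.comp (ContinuousAt.sub ?_ ?_)
      · exact (continuousAt_signSeries hf1 c).comp
          (f := fun v : X × (ℕ → Bool) => (f v.1, v.2))
          ((hf.comp (f := Prod.fst) (x := (x₀, c)) continuousAt_fst).prodMk continuousAt_snd)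
      · exact hg.comp (f := Prod.fst) (x := (x₀, c)) continuousAt_fst
    exact hcont.eventually_const_lt ((half_lt_self (hpos c₀)).trans_le (hmin (mem_univ c)))
  filter_upwards [hev] with x hx
  rintro _ ⟨c, rfl⟩ τ hτ
  refine (hx c (mem_univ c)).le.trans ((Metric.infDist_le_dist_of_mem
    (show (τ * Complex.I : ℂ) ∈ R by simp [hR, hτ])).trans_eq ?_)
  rw [dist_eq_norm, dist_eq_norm, sub_sub]

end SchottkySemigroup

/-! ### Hurwitz's theorem and prescribed displacements of truncations -/

/-- **Hurwitz's theorem**: if holomorphic functions converge uniformly on a closed disc to a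
function that vanishes at the center but not on the boundary circle, then they eventually vanish
somewhere in the disc. -/
theorem TendstoUniformlyOn.eventually_exists_eq_zero {f : ℂ → ℂ} {h : ℕ → ℂ → ℂ} {z₀ : ℂ} {ρ : ℝ}
    (hρ : 0 < ρ) (hlim : TendstoUniformlyOn h f atTop (Metric.closedBall z₀ ρ))
    (hh : ∀ n, Differentiable ℂ (h n)) (hfc : ContinuousOn f (Metric.sphere z₀ ρ))
    (hf0 : f z₀ = 0) (hf : ∀ z ∈ Metric.sphere z₀ ρ, f z ≠ 0) :
    ∀ᶠ n in atTop, ∃ z ∈ Metric.closedBall z₀ ρ, h n z = 0 := by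
  obtain ⟨w, hw, hmin⟩ := (isCompact_sphere z₀ ρ).exists_isMinOn
    (NormedSpace.sphere_nonempty.2 hρ.le) hfc.norm
  have hμ : 0 < ‖f w‖ := norm_pos_iff.2 (hf w hw)
  filter_upwards [Metric.tendstoUniformlyOn_iff.1 hlim _ (half_pos hμ)] with n hn
  by_contra! hne
  have hlow : ∀ z ∈ Metric.sphere z₀ ρ, ‖f w‖ / 2 ≤ ‖h n z‖ := fun z hz => by
    have h1 : ‖f w‖ ≤ ‖f z‖ := hmin hz
    have h2 := hn z (Metric.sphere_subset_closedBall hz)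
    have h3 := norm_sub_norm_le (f z) (h n z)
    rw [dist_eq_norm] at h2
    linarith
  -- The maximum principle for 1 / h n would give |h n| ≥ ‖f w‖ / 2 at the center, where f vanishes
  -- and h n is smaller than that.
  have hd : DiffContOnCl ℂ (fun z => (h n z)⁻¹) (Metric.ball z₀ ρ) := by
    refine DifferentiableOn.diffContOnCl fun z hz => ?_
    rw [closure_ball _ hρ.ne'] at hz
    exact ((hh n z).inv (hne z hz)).differentiableWithinAt
  have hmax := Complex.norm_le_of_forall_mem_frontier_norm_le Metric.isBounded_ball hd
    (C := (‖f w‖ / 2)⁻¹) (fun z hz => by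
      rw [frontier_ball _ hρ.ne'] at hz
      rw [norm_inv]
      exact inv_anti₀ (half_pos hμ) (hlow z hz))
    (subset_closure (Metric.mem_ball_self hρ))
  have hz0 := hne z₀ (Metric.mem_closedBall_self hρ.le)
  rw [norm_inv, inv_le_inv₀ (norm_pos_iff.2 hz0) (half_pos hμ)] at hmax
  have := hn z₀ (Metric.mem_closedBall_self hρ.le)
  rw [hf0, dist_zero_left] at this
  linarith

namespace SchottkySemigroup

theorem norm_signSeries_le {z : ℂ} (hz : ‖z‖ < 1) (a : ℕ → Bool) :
    ‖signSeries z a‖ ≤ (1 - ‖z‖)⁻¹ :=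
  tsum_of_norm_bounded (hasSum_geometric_of_lt_one (norm_nonneg z) hz) fun i => by
    rw [norm_mul, norm_sign, one_mul, norm_pow]

theorem analyticOnNhd_signSeries (a : ℕ → Bool) :
    AnalyticOnNhd ℂ (fun z => signSeries z a) (Metric.ball 0 1) := by
  refine DifferentiableOn.analyticOnNhd (fun z hz => ?_) Metric.isOpen_ball
  obtain ⟨r, hzr, hr⟩ := exists_between (show ‖z‖ < 1 by simpa using hz)
  have hr0 := (norm_nonneg z).trans hzr.le
  have : DifferentiableOn ℂ (fun z => signSeries z a) (Metric.ball 0 r) :=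
    Complex.differentiableOn_tsum_of_summable_norm (u := fun i => r ^ i)
      (summable_geometric_of_lt_one hr0 hr) (fun i => by fun_prop) Metric.isOpen_ball
      fun i w hw => by
        have h : ‖w‖ < r := by simpa using hw
        rw [norm_mul, norm_sign, one_mul, norm_pow]
        exact pow_le_pow_left₀ (norm_nonneg _) h.le i
  exact (this.differentiableAt
    (Metric.isOpen_ball.mem_nhds (by simpa using hzr))).differentiableWithinAt

theorem signSeries_eq_sum_add {z : ℂ} (hz : ‖z‖ < 1) (a : ℕ → Bool) (n : ℕ) :
    signSeries z a = ∑ i ∈ Finset.range n, (sign (a i) : ℂ) * z ^ i +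
      z ^ n * signSeries z fun i => a (i + n) := by
  conv_lhs => rw [← splice_self n a, signSeries_splice hz]

/-- Near a common value of two series, their truncations differ by a prescribed multiple of the
next power of the variable. -/
theorem exists_sum_sub_sum_eq {z₀ : ℂ} (hz₀ : ‖z₀‖ < 1) {a b : ℕ → Bool} (hab : a 0 ≠ b 0)
    (h : signSeries z₀ a = signSeries z₀ b) (m : ℂ) {ε : ℝ} (hε : 0 < ε) :
    ∃ z, dist z z₀ < ε ∧ ∃ n : ℕ, ∑ i ∈ Finset.range (n + 1), (sign (a i) : ℂ) * z ^ i -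
      ∑ i ∈ Finset.range (n + 1), (sign (b i) : ℂ) * z ^ i = m * z ^ (n + 1) := by
  set f : ℂ → ℂ := fun z => signSeries z a - signSeries z b with hf
  have hfa : AnalyticOnNhd ℂ f (Metric.ball 0 1) :=
    (analyticOnNhd_signSeries a).sub (analyticOnNhd_signSeries b)
  have hmem : z₀ ∈ Metric.ball (0 : ℂ) 1 := by simpa using hz₀
  have hne : ∀ᶠ z in 𝓝[≠] z₀, f z ≠ 0 := by
    -- f is not identically zero, since f 0 = ±2 by `hab`.
    refine (hfa z₀ hmem).eventually_eq_zero_or_eventually_ne_zero.resolve_left fun h0 => ?_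
    have := hfa.eqOn_zero_of_preconnected_of_eventuallyEq_zero
      (convex_ball 0 1).isPreconnected hmem h0 (Metric.mem_ball_self one_pos)
    simp only [hf, Pi.zero_apply] at this
    rw [signSeries_eq (by simp) a, signSeries_eq (by simp) b] at this
    revert hab this
    cases a 0 <;> cases b 0 <;> norm_num [sign]
  rw [eventually_nhdsWithin_iff] at hne
  obtain ⟨η, hη, hball⟩ := Metric.eventually_nhds_iff.1
    (hne.and (Metric.isOpen_ball.mem_nhds hmem))
  obtain ⟨ρ, hρ, hρ'⟩ := exists_between (lt_min hε hη)
  obtain ⟨hρε, hρη⟩ := lt_min_iff.1 hρ'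
  have hsub : Metric.closedBall z₀ ρ ⊆ Metric.ball 0 1 := fun z hz =>
    (hball ((Metric.mem_closedBall.1 hz).trans_lt hρη)).2
  have hcont : ContinuousOn f (Metric.ball 0 1) := hfa.continuousOn
  obtain ⟨w, hw, hmax⟩ := (isCompact_closedBall z₀ ρ).exists_isMaxOn
    ⟨z₀, Metric.mem_closedBall_self hρ.le⟩ continuous_norm.continuousOn
  have hw1 : ‖w‖ < 1 := by simpa using hsub hw
  -- f − H n is z^(n+1) times a bounded factor, and |z| ≤ ‖w‖ < 1 on the disc, so convergence is
  -- uniform.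
  set H : ℕ → ℂ → ℂ := fun n z => ∑ i ∈ Finset.range (n + 1), (sign (a i) : ℂ) * z ^ i -
      ∑ i ∈ Finset.range (n + 1), (sign (b i) : ℂ) * z ^ i - m * z ^ (n + 1) with hH
  have hlim : TendstoUniformlyOn H f atTop (Metric.closedBall z₀ ρ) := by
    rw [Metric.tendstoUniformlyOn_iff]
    intro e he
    have h0 : Tendsto (fun n : ℕ => ‖w‖ ^ (n + 1) * ((1 - ‖w‖)⁻¹ + (1 - ‖w‖)⁻¹ + ‖m‖)) atTop
        (𝓝 0) := by
      simpa using ((tendsto_pow_atTop_nhds_zero_of_lt_one (norm_nonneg w) hw1).comp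
        (tendsto_add_atTop_nat 1)).mul_const ((1 - ‖w‖)⁻¹ + (1 - ‖w‖)⁻¹ + ‖m‖)
    filter_upwards [h0.eventually (gt_mem_nhds he)] with n hn z hz
    refine lt_of_le_of_lt ?_ hn
    have hz1 : ‖z‖ < 1 := by simpa using hsub hz
    have hzw : ‖z‖ ≤ ‖w‖ := hmax hz
    have heq : f z - H n z = z ^ (n + 1) * ((signSeries z fun i => a (i + (n + 1))) -
        (signSeries z fun i => b (i + (n + 1))) + m) := by
      simp only [hf, hH]
      rw [signSeries_eq_sum_add hz1 a (n + 1), signSeries_eq_sum_add hz1 b (n + 1)]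
      ring
    rw [dist_eq_norm, heq, norm_mul, norm_pow]
    have hle : ∀ c, ‖signSeries z c‖ ≤ (1 - ‖w‖)⁻¹ := fun c =>
      (norm_signSeries_le hz1 c).trans (inv_anti₀ (by linarith) (by linarith))
    gcongr
    refine (norm_add_le _ _).trans ?_
    gcongr
    exact (norm_sub_le _ _).trans (add_le_add (hle _) (hle _))
  obtain ⟨n, z, hz, hn⟩ := (hlim.eventually_exists_eq_zero hρ (fun n => by fun_prop)
    (hcont.mono (Metric.sphere_subset_closedBall.trans hsub)) (by simp [hf, h]) (fun z hz =>
      (hball (by rwa [Metric.mem_sphere.1 hz])).1 (by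
        rintro rfl
        rw [Metric.mem_sphere, dist_self] at hz
        exact hρ.ne hz))).exists
  exact ⟨z, (Metric.mem_closedBall.1 hz).trans_lt hρε, n, sub_eq_zero.1 hn⟩

/-! ### Traps -/

/-- Traps: the pieces of the attractor whose relative displacement is close to a certain vector
must approach each other, for all parameters close to a given one. -/
theorem exists_eventually_overlap {z₀ : ℂ} (him : z₀.im ≠ 0) (hz₀ : ‖z₀‖ ^ 2 < 1 / 2)
    {a b : ℕ → Bool} (ha : a 0 = true) (hb : b 0 = false)
    (hab : signSeries z₀ a = signSeries z₀ b) :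
    ∃ m : ℂ, ∀ᶠ x : ℂ × ℂ in 𝓝 (z₀, m), ∀ n : ℕ,
      ∑ i ∈ Finset.range (n + 1), (sign (a i) : ℂ) * x.1 ^ i -
        ∑ i ∈ Finset.range (n + 1), (sign (b i) : ℂ) * x.1 ^ i = x.2 * x.1 ^ (n + 1) →
      Overlap x.1 := by
  have hz₁ : ‖z₀‖ < 1 := by nlinarith [norm_nonneg z₀]
  have hz₂ : 0 < ‖z₀‖ := norm_pos_iff.2 fun h => him (by simp [h])
  -- The signs are frozen at z₀: `topSigns z` may jump with z, whereas p and q remain continuous.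
  set p : ℂ → ℂ := fun z => signSeries z (topSigns z₀ false) with hp
  set q : ℂ → ℂ := fun z => signSeries z (topSigns z₀ true) with hq
  set m : ℂ := (q z₀ - p z₀) / 2 with hm
  refine ⟨m, ?_⟩
  have hser : ∀ c, ContinuousAt (fun x : ℂ × ℂ => signSeries x.1 c) (z₀, m) := fun c =>
    (continuousAt_signSeries hz₁ c).comp (f := fun x : ℂ × ℂ => (x.1, c)) (x := (z₀, m))
      (by fun_prop)
  have hpc : ContinuousAt (fun x : ℂ × ℂ => p x.1) (z₀, m) := hser _
  have hqc : ContinuousAt (fun x : ℂ × ℂ => q x.1) (z₀, m) := hser _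
  have hpq : (p z₀).re < (q z₀).re := re_signSeries_topSigns_lt hz₁
  have hpqi : (p z₀).im = (q z₀).im := by
    simp only [hp, hq, im_signSeries_topSigns hz₁]
  have hmre : m.re = ((q z₀).re - (p z₀).re) / 2 := by simp [hm]
  have hmim : m.im = 0 := by simp [hm, hpqi]
  have hray : ∀ c, (q z₀).im ≤ (signSeries z₀ c).im →
      (p z₀).re ≤ (signSeries z₀ c).re ∧ (signSeries z₀ c).re ≤ (q z₀).re ∧
        2 * (signSeries z₀ c).re ≠ (p z₀).re + (q z₀).re := fun c hc =>
    ⟨(re_signSeries_mem_Icc_of_im_le hz₁ hc).1, (re_signSeries_mem_Icc_of_im_le hz₁ hc).2,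
      two_mul_re_signSeries_ne_of_im_le him hz₀ hc⟩
  have hdist : ∀ g : ℂ × ℂ → ℂ, ContinuousAt g (z₀, m) → (g (z₀, m)).im = (q z₀).im →
      ((g (z₀, m)).re < (p z₀).re ∨ (q z₀).re < (g (z₀, m)).re ∨
        2 * (g (z₀, m)).re = (p z₀).re + (q z₀).re) →
      ∃ ρ > 0, ∀ᶠ x : ℂ × ℂ in 𝓝 (z₀, m), ∀ k ∈ attractor x.1, ∀ τ : ℝ, 0 ≤ τ →
        ρ ≤ dist k (g x + τ * Complex.I) := by
    intro g hg hgi hgr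
    refine exists_eventually_le_dist_ray (f := Prod.fst) continuousAt_fst hz₁ hg fun c hc => ?_
    by_contra! hcon
    rw [hgi] at hcon
    obtain ⟨h1, h2, h3⟩ := hray c hcon
    rw [← hc] at hgr
    rcases hgr with h | h | h
    · linarith
    · linarith
    · exact h3 h
  -- At the base point p − m and q + m lie beyond the ends of the top side, while q − m and p + m
  -- are its midpoint; the rays above all four miss the attractor.
  obtain ⟨ρ₁, hρ₁, e₁⟩ := hdist (fun x => p x.1 + -x.2)
    (hpc.add continuous_snd.neg.continuousAt) (by simp [hmim, hpqi])
    (.inl (by simp [hmre]; linarith))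
  obtain ⟨ρ₂, hρ₂, e₂⟩ := hdist (fun x => q x.1 + -x.2)
    (hqc.add continuous_snd.neg.continuousAt) (by simp [hmim])
    (.inr (.inr (by simp [hmre]; ring)))
  obtain ⟨ρ₃, hρ₃, e₃⟩ := hdist (fun x => p x.1 - -x.2)
    (hpc.sub continuous_snd.neg.continuousAt) (by simp [hmim, hpqi])
    (.inr (.inr (by simp [hmre]; ring)))
  obtain ⟨ρ₄, hρ₄, e₄⟩ := hdist (fun x => q x.1 - -x.2)
    (hqc.sub continuous_snd.neg.continuousAt) (by simp [hmim])
    (.inr (.inl (by simp [hmre]; linarith)))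
  obtain ⟨ρ, hρ, hρle⟩ : ∃ ρ > 0, ρ ≤ ρ₁ ∧ ρ ≤ ρ₂ ∧ ρ ≤ ρ₃ ∧ ρ ≤ ρ₄ :=
    ⟨min (min ρ₁ ρ₂) (min ρ₃ ρ₄), by positivity, by simp, by simp, by simp, by simp⟩
  -- The distance between the pieces is at most this norm, so it is small compared with ρ near z₀.
  have e₅ : ∀ᶠ x : ℂ × ℂ in 𝓝 (z₀, m), ‖signSeries x.1 a - signSeries x.1 b‖ < 2 * ρ * ‖x.1‖ := by
    refine ContinuousAt.eventually_lt ((hser a).sub (hser b)).norm (by fun_prop) ?_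
    simp only [hab, sub_self, norm_zero]
    positivity
  have e₆ : ∀ᶠ x : ℂ × ℂ in 𝓝 (z₀, m), (-x.2).re < 0 := by
    refine ContinuousAt.eventually_lt (by fun_prop) continuousAt_const ?_
    simp [hmre, hpq]
  have e₇ : ∀ᶠ x : ℂ × ℂ in 𝓝 (z₀, m), (p x.1).re < (q x.1 + -x.2).re := by
    refine ContinuousAt.eventually_lt (Complex.continuous_re.continuousAt.comp hpc)
      (Complex.continuous_re.continuousAt.comp (hqc.add (by fun_prop))) ?_
    simp [hmre]
    linarith
  have e₈ : ∀ᶠ x : ℂ × ℂ in 𝓝 (z₀, m), ‖x.1‖ < 1 :=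
    ContinuousAt.eventually_lt (by fun_prop) continuousAt_const hz₁
  filter_upwards [e₁, e₂, e₃, e₄, e₅, e₆, e₇, e₈] with ⟨z, w⟩ h₁ h₂ h₃ h₄ h₅ h₆ h₇ hz n hn
  simp only at h₁ h₂ h₃ h₄ h₅ h₆ h₇ hz hn ⊢
  by_contra hno
  obtain ⟨δ, hδ, ⟨u, hu, v, hv, huv⟩, hgap⟩ := exists_gap hz hno
  have hzpos : 0 < ‖z‖ := by
    by_contra! h0
    rw [le_antisymm h0 (norm_nonneg z)] at h₅
    linarith [norm_nonneg (signSeries z a - signSeries z b)]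
  have hδρ : δ / (2 * ‖z‖) ≤ ρ := by
    rw [div_le_iff₀ (by positivity)]
    refine ((hgap _ ⟨fun i => a (i + 1), rfl⟩ _ ⟨fun i => b (i + 1), rfl⟩).trans ?_)
    rw [signSeries_eq hz a, signSeries_eq hz b, ha, hb, ← dist_eq_norm] at h₅
    simp only [sign] at h₅
    simp at h₅
    linarith
  -- The radius δ / (2‖z‖) is large enough for δ-chains to give paths. Doubled and scaled by
  -- ‖z‖^(n+1), it becomes ‖z‖^n δ ≤ δ, which contradicts the gap.
  have hδlt : δ / 2 < δ / (2 * ‖z‖) := by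
    gcongr
    linarith
  obtain ⟨k, ⟨s, rfl⟩, l, ⟨t, rfl⟩, hkl⟩ := exists_dist_add_lt_of_rays (K := attractor z) hδ hδlt
    (fun x hx y hy => exists_chain hz hδ hu hv huv.le hx hy) ⟨_, rfl⟩ ⟨_, rfl⟩ h₆ h₇
    (fun k hk τ hτ => (hδρ.trans hρle.1).trans (h₁ k hk τ hτ))
    (fun k hk τ hτ => (hδρ.trans hρle.2.1).trans (h₂ k hk τ hτ))
    (fun k hk τ hτ => (hδρ.trans hρle.2.2.1).trans (h₃ k hk τ hτ))
    (fun k hk τ hτ => (hδρ.trans hρle.2.2.2).trans (h₄ k hk τ hτ))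
  have hU := signSeries_splice hz (n + 1) a s
  have hV := signSeries_splice hz (n + 1) b t
  have hUV : signSeries z (splice (n + 1) a s) - signSeries z (splice (n + 1) b t) =
      z ^ (n + 1) * (signSeries z s - (signSeries z t + -w)) := by
    rw [hU, hV]
    linear_combination hn
  have hle : δ ≤ ‖signSeries z (splice (n + 1) a s) - signSeries z (splice (n + 1) b t)‖ := by
    rw [signSeries_eq hz, signSeries_eq hz (splice (n + 1) b t), ← dist_eq_norm]
    have := hgap _ ⟨fun i => splice (n + 1) a s (i + 1), rfl⟩ _
      ⟨fun i => splice (n + 1) b t (i + 1), rfl⟩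
    simpa [splice, ha, hb, sign] using this
  rw [hUV, norm_mul, ← dist_eq_norm, norm_pow] at hle
  have hlt : ‖z‖ ^ (n + 1) * dist (signSeries z s) (signSeries z t + -w) <
      ‖z‖ ^ (n + 1) * (2 * (δ / (2 * ‖z‖))) := by gcongr
  have heq : ‖z‖ ^ (n + 1) * (2 * (δ / (2 * ‖z‖))) = ‖z‖ ^ n * δ := by
    field_simp
    exact pow_succ' _ _
  have := mul_le_of_le_one_left hδ.le (pow_le_one₀ (n := n) (norm_nonneg z) hz.le)
  linarith

/-! ### Density of the interior -/

theorem mem_interior_connectednessLocus {z : PuncturedDisk}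
    (h : ∀ᶠ w in 𝓝 (z : ℂ), ‖w‖ < 1 → Overlap w) : z ∈ interior connectednessLocus := by
  rw [mem_interior_iff_mem_nhds]
  filter_upwards [continuous_subtype_val.continuousAt.eventually h] with w hw
  exact (mem_connectednessLocus_iff w).2 (hw w.2.2)

/-- A slight radial push outward lands in the open region |w|² > 1/2, where the pieces always
overlap. -/
theorem mem_closure_interior_of_half_le {z : PuncturedDisk} (hz : 1 / 2 ≤ ‖(z : ℂ)‖ ^ 2) :
    z ∈ closure (interior connectednessLocus) := by
  rw [Metric.mem_closure_iff]
  intro ε hε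
  obtain ⟨s, hs, hs'⟩ := exists_between (lt_min z.2.2 (lt_add_of_pos_right ‖(z : ℂ)‖ hε))
  obtain ⟨hs1, hsε⟩ := lt_min_iff.1 hs'
  have hz0 := z.2.1
  have hs0 := hz0.trans hs
  set w : ℂ := ((s / ‖(z : ℂ)‖ : ℝ) : ℂ) * z with hw
  have hwn : ‖w‖ = s := by
    rw [hw, norm_mul, Complex.norm_real, Real.norm_of_nonneg (by positivity)]
    field_simp
  refine ⟨⟨w, by rw [hwn]; exact hz0.trans hs, by rwa [hwn]⟩,
    mem_interior_connectednessLocus ?_, ?_⟩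
  · have : 1 / 2 < ‖w‖ ^ 2 := by
      rw [hwn]
      nlinarith
    filter_upwards [ContinuousAt.eventually_lt continuousAt_const
      (continuous_norm.pow 2).continuousAt this] with v hv hv1
    exact overlap_of_half_lt hv1 hv
  · rw [Subtype.dist_eq, dist_eq_norm]
    have : (z : ℂ) - w = ((1 - s / ‖(z : ℂ)‖ : ℝ) : ℂ) * z := by
      rw [hw]
      push_cast
      ring
    rw [this, norm_mul, Complex.norm_real, Real.norm_eq_abs, abs_sub_comm, abs_of_nonneg]
    · rw [sub_mul, div_mul_cancel₀ _ hz0.ne']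
      linarith
    · rw [sub_nonneg, one_le_div hz0]
      exact hs.le

theorem mem_closure_interior_of_lt_half {z : PuncturedDisk} (hz : ‖(z : ℂ)‖ ^ 2 < 1 / 2)
    (him : (z : ℂ).im ≠ 0) (hmem : z ∈ connectednessLocus) :
    z ∈ closure (interior connectednessLocus) := by
  obtain ⟨a, b, ha, hb, hab⟩ := (mem_connectednessLocus_iff z).1 hmem
  obtain ⟨m, hm⟩ := exists_eventually_overlap him hz ha hb hab
  have hm' := (continuousAt_id.prodMk continuousAt_const).eventually
    (eventually_eventually_nhds.2 hm)
  rw [Metric.mem_closure_iff]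
  intro ε hε
  have hopen : IsOpen {w : ℂ | 0 < ‖w‖ ∧ ‖w‖ < 1} :=
    (isOpen_lt continuous_const continuous_norm).inter (isOpen_lt continuous_norm continuous_const)
  obtain ⟨η, hη, hball⟩ := Metric.eventually_nhds_iff.1 (hm'.and (hopen.mem_nhds z.2))
  obtain ⟨w, hw, n, hn⟩ := exists_sum_sub_sum_eq z.2.2 (a := a) (b := b) (by simp [ha, hb]) hab m
    (lt_min hε hη)
  obtain ⟨hwε, hwη⟩ := lt_min_iff.1 hw
  obtain ⟨hev, hwD⟩ := hball hwη
  have hw0 : w ≠ 0 := norm_pos_iff.1 hwD.1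
  refine ⟨⟨w, hwD⟩, mem_interior_connectednessLocus ?_, ?_⟩
  -- g pairs a parameter with the normalized displacement of its two truncations. It is continuous
  -- at w with value (w, m), so parameters near w stay in the trap with the same n.
  · set g : ℂ → ℂ × ℂ := fun v => (v, (∑ i ∈ Finset.range (n + 1), (sign (a i) : ℂ) * v ^ i -
      ∑ i ∈ Finset.range (n + 1), (sign (b i) : ℂ) * v ^ i) / v ^ (n + 1)) with hg
    have hgw : g w = (w, m) := by
      simp only [hg]
      rw [hn, mul_div_cancel_right₀ _ (pow_ne_zero _ hw0)]
    have hgc : ContinuousAt g w :=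
      continuousAt_id.prodMk (ContinuousAt.div (by fun_prop) (by fun_prop) (pow_ne_zero _ hw0))
    have := hgc.eventually (by rw [hgw]; exact hev)
    filter_upwards [this, isOpen_ne.mem_nhds hw0] with v hv hv0 _
    refine hv n ?_
    simp only [hg]
    rw [div_mul_cancel₀ _ (pow_ne_zero _ hv0)]
  · rw [Subtype.dist_eq, dist_comm]
    exact hwε

end SchottkySemigroup

theorem mainTheorem1 :
    SchottkySemigroup.connectednessLocus =
      closure (interior SchottkySemigroup.connectednessLocus) ∪
        (SchottkySemigroup.connectednessLocus ∩
          {z : SchottkySemigroup.PuncturedDisk | (z : ℂ).im = 0}) := by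
  apply Subset.antisymm
  · intro z hz
    by_cases him : (z : ℂ).im = 0
    · exact .inr ⟨hz, him⟩
    · rcases lt_or_ge (‖(z : ℂ)‖ ^ 2) (1 / 2) with h | h
      · exact .inl (SchottkySemigroup.mem_closure_interior_of_lt_half h him hz)
      · exact .inl (SchottkySemigroup.mem_closure_interior_of_half_le h)
  · exact union_subset (closure_minimal interior_subset
      SchottkySemigroup.isClosed_connectednessLocus) inter_subset_left
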